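/- Let $(A,\mathfrak m)$ be a Cohen–Macaulay (Noetherian) local ring of dimension $d\ge 1$, and let $\mathfrak a=(f_1,\dots,f_d)$ be a parameter ideal, i.e. an $\mathfrak m$-primary ideal generated by $d$ elements. Let $\mathcal J=\{\mathcal J_c\}_{c\ge 0}$ be an $\mathbb R$-good $\mathfrak a$-filtration by ideals of $A$: a decreasing family of ideals that is constant away from a discrete set of positive real numbers (there is a set $S\subset\mathbb R_{>0}$, finite in every bounded interval, such that $\mathcal J_x=\mathcal J_y$ whenever $0\le x\le y$ and $S\cap(x,y]=\emptyset$), with $\mathcal J_{c+1}=\mathfrak a\mathcal J_c$ for all $c$ large enough. Assume that every $\mathcal J_c$ is $\mathfrak m$-primary or equal to $A$, and that $\mathcal J_c=\mathfrak a\,\mathcal J_{c-1}$ for all $c>d$. For $c>0$ let $m(c)=\lambda(\mathcal J_{c-\varepsilon}/\mathcal J_c)$ for $\varepsilon>0$ small enough, where $\lambda$ denotes length, and let $$P_{\mathcal J}(T)=\sum_{c\in\mathbb R_{>0}} m(c)\,T^c$$ be the Poincaré series, a formal series with real exponents. Then for every $c\in(0,1]$ there are integers $\alpha_{1},\dots,\alpha_{d}$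 and a polynomial $p(T)\in\mathbb Z[T]$, all depending on $c$, such that $$P_{\mathcal J}(T)=\sum_{c\in(0,1]}\left(m(c)+\cdots+m(c+d-2)T^{d-2}+\frac{m(c+d-1)T^{d-1}}{(1-T)^d}+T^d\left(\frac{\alpha_{d}}{(1-T)^d}+\cdots+\frac{\alpha_{1}}{1-T}+p(T)\right)\right)T^c,$$ where only finitely many summands on the right are nonzero and the identity holds in the field of formal (Hahn) series in $T$ with real exponents and rational coefficients (for $d=1$ the part $m(c)+\cdots+m(c+d-2)T^{d-2}$ is empty). -/

import Mathlib

open IsLocalRing Filter Topology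

/-- A Cohen-Macaulay local ring: a Noetherian local ring whose maximal ideal contains a regular
sequence of length `dim A` (equivalently `depth A = dim A`, as regular sequences in the maximal
ideal have at most `dim A` elements). -/
structure IsCohenMacaulayLocal (A : Type*) [CommRing A] [IsLocalRing A] : Prop where
  noetherian : IsNoetherianRing A
  exists_regular : ∃ rs : List A, (∀ r ∈ rs, r ∈ maximalIdeal A) ∧
    RingTheory.Sequence.IsRegular A rs ∧ ((rs.length : ℕ) : WithBot ℕ∞) = ringKrullDim A

/-- `I` is an `𝔪`-primary ideal of the local ring `A`. -/
def IsMaximalPrimary {A : Type*} [CommRing A] [IsLocalRing A] (I : Ideal A) : Prop :=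
  I.IsPrimary ∧ I.radical = maximalIdeal A

/-- A parameter ideal of a local ring of dimension `d`: an `𝔪`-primary ideal generated by `d`
elements. -/
def IsParameterIdeal {A : Type*} [CommRing A] [IsLocalRing A] (𝔞 : Ideal A) : Prop :=
  ∃ (d : ℕ) (f : Fin d → A), ringKrullDim A = d ∧ 𝔞 = Ideal.span (Set.range f) ∧
    IsMaximalPrimary 𝔞

/-- An `ℝ`-good `𝔞`-filtration `{J_c}_{c ≥ 0}` by ideals (a filtration of the module `J_0`): it is
decreasing, it is constant away from a discrete set `S` of positive real numbers (that is, `J_c`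
does not change on `[x, y]` if `S` has no point in `(x, y]`), and `J_{c+1} = 𝔞 J_c` for `c` large.
The indexing is by all of `ℝ`, but the values at negative indices play no role. -/
structure RGoodFiltration {A : Type*} [CommRing A] (𝔞 : Ideal A) where
  ideal : ℝ → Ideal A
  antitone : AntitoneOn ideal (Set.Ici 0)
  discrete : ∃ S : Set ℝ, S ⊆ Set.Ioi 0 ∧ (∀ b : ℝ, (S ∩ Set.Iic b).Finite) ∧
    ∀ x y : ℝ, 0 ≤ x → x ≤ y → S ∩ Set.Ioc x y = ∅ → ideal x = ideal y
  good : ∃ j : ℝ, ∀ c : ℝ, 0 ≤ c → j < c → ideal (c + 1) = 𝔞 * ideal c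

namespace RGoodFiltration

variable {A : Type*} [CommRing A] {𝔞 : Ideal A}

/-- The ideal `J_{c-ε}` for all sufficiently small `ε > 0` (see `eventually_eq_leftIdeal`). -/
def leftIdeal (J : RGoodFiltration 𝔞) (c : ℝ) : Ideal A :=
  ⨅ b ∈ Set.Ico 0 c, J.ideal b

/-- The multiplicity `m(c) = λ(J_{c-ε} / J_c)`, for `ε > 0` small enough, of a number `c > 0`
(see `eventually_multiplicity_eq`). -/
noncomputable def multiplicity (J : RGoodFiltration 𝔞) (c : ℝ) : ℕ :=
  (Module.length A (J.leftIdeal c ⧸ (J.ideal c).submoduleOf (J.leftIdeal c))).toNat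

theorem eventually_eq_leftIdeal (J : RGoodFiltration 𝔞) {c : ℝ} (hc : 0 < c) :
    ∀ᶠ ε in 𝓝[>] (0 : ℝ), J.leftIdeal c = J.ideal (c - ε) := by
  obtain ⟨S, -, hfin, hconst⟩ := J.discrete
  have hev : ∀ᶠ x in 𝓝[<] c, ∀ s ∈ S ∩ Set.Iic c, s ≠ c → s < x := by
    rw [Filter.eventually_all_finite (hfin c)]
    intro s hs
    by_cases h : s = c
    · simp [h]
    · have hlt : s < c := lt_of_le_of_ne hs.2 h
      filter_upwards [Ioo_mem_nhdsLT hlt] with x hx _ using hx.1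
  have hev2 : ∀ᶠ x in 𝓝[<] c, J.leftIdeal c = J.ideal x := by
    filter_upwards [hev, Ioo_mem_nhdsLT hc] with x hx hx0
    refine le_antisymm (iInf₂_le x ⟨hx0.1.le, hx0.2⟩) (le_iInf₂ fun b hb => ?_)
    rcases le_total b x with h | h
    · exact J.antitone hb.1 (Set.mem_Ici.2 hx0.1.le) h
    · refine (hconst x b hx0.1.le h ?_).le
      ext s
      simp only [Set.mem_inter_iff, Set.mem_Ioc, Set.mem_empty_iff_false, iff_false]
      rintro ⟨hs, h1, h2⟩
      have hsc : s < c := h2.trans_lt hb.2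
      exact absurd (hx s ⟨hs, hsc.le⟩ hsc.ne) (not_lt.2 h1.le)
  have ht : Tendsto (fun ε : ℝ => c - ε) (𝓝[>] 0) (𝓝[<] c) := by
    refine tendsto_nhdsWithin_iff.2 ⟨?_, ?_⟩
    · have : Tendsto (fun ε : ℝ => c - ε) (𝓝 0) (𝓝 (c - 0)) := by
        exact (continuous_const.sub continuous_id).tendsto 0
      rw [sub_zero] at this
      exact this.mono_left nhdsWithin_le_nhds
    · filter_upwards [self_mem_nhdsWithin] with ε hε
      simpa using hε
  exact ht.eventually hev2

theorem multiplicity_eq_zero_of_notMem (J : RGoodFiltration 𝔞) {S : Set ℝ}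
    (hfin : ∀ b : ℝ, (S ∩ Set.Iic b).Finite)
    (hconst : ∀ x y : ℝ, 0 ≤ x → x ≤ y → S ∩ Set.Ioc x y = ∅ → J.ideal x = J.ideal y)
    {c : ℝ} (hc : 0 < c) (hS : c ∉ S) : J.multiplicity c = 0 := by
  have hev : ∀ᶠ x in 𝓝[<] c, ∀ s ∈ S ∩ Set.Iic c, s < x := by
    rw [Filter.eventually_all_finite (hfin c)]
    intro s hs
    have hlt : s < c := lt_of_le_of_ne hs.2 (by rintro rfl; exact hS hs.1)
    filter_upwards [Ioo_mem_nhdsLT hlt] with x hx using hx.1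
  obtain ⟨x, hx, hx0⟩ := (hev.and (Ioo_mem_nhdsLT hc)).exists
  have hle : J.leftIdeal c ≤ J.ideal c := by
    refine (iInf₂_le x ⟨hx0.1.le, hx0.2⟩).trans (hconst x c hx0.1.le hx0.2.le ?_).le
    ext s
    simp only [Set.mem_inter_iff, Set.mem_Ioc, Set.mem_empty_iff_false, iff_false]
    rintro ⟨hs, h1, h2⟩
    exact absurd (hx s ⟨hs, h2⟩) (not_lt.2 h1.le)
  have htop : (J.ideal c).submoduleOf (J.leftIdeal c) = ⊤ :=
    Submodule.submoduleOf_eq_top.2 hle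
  have : Subsingleton (J.leftIdeal c ⧸ (J.ideal c).submoduleOf (J.leftIdeal c)) :=
    Submodule.Quotient.subsingleton_iff.2 htop
  rw [multiplicity, Module.length_eq_zero]
  rfl

/-- For a filtration of ideals that are `𝔪`-primary or the unit ideal, `m(c)` is the length of
`J_{c-ε} / J_c` for all small `ε > 0`; in particular that length is finite. -/
theorem eventually_multiplicity_eq [IsLocalRing A] [IsNoetherianRing A] (J : RGoodFiltration 𝔞)
    {c : ℝ} (hc : 0 < c) (hJ : J.ideal c = ⊤ ∨ IsMaximalPrimary (J.ideal c)) :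
    ∀ᶠ ε in 𝓝[>] (0 : ℝ), (J.multiplicity c : ℕ∞) = Module.length A
      (J.ideal (c - ε) ⧸ (J.ideal c).submoduleOf (J.ideal (c - ε))) := by
  filter_upwards [J.eventually_eq_leftIdeal hc] with ε hε
  rw [← hε, multiplicity]
  refine ENat.natCast_toNat ?_
  have hfin : Module.length A (A ⧸ J.ideal c) ≠ ⊤ := by
    rcases hJ with h | h
    · have : Subsingleton (A ⧸ J.ideal c) := Ideal.Quotient.subsingleton_iff.2 h
      rw [Module.length_eq_zero]
      exact ENat.zero_ne_top
    · have hrad : (J.ideal c).radical = maximalIdeal A := h.2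
      have hz : Ring.KrullDimLE 0 (A ⧸ J.ideal c) := by
        rw [Ring.krullDimLE_zero_iff]
        intro P hP
        have hQ : (P.comap (Ideal.Quotient.mk (J.ideal c))).IsPrime := hP.comap _
        have hle : J.ideal c ≤ P.comap (Ideal.Quotient.mk (J.ideal c)) := by
          intro x hx
          rw [Ideal.mem_comap, Ideal.Quotient.eq_zero_iff_mem.2 hx]
          exact P.zero_mem
        have hmax : maximalIdeal A = P.comap (Ideal.Quotient.mk (J.ideal c)) :=
          (maximalIdeal.isMaximal A).eq_of_le hQ.ne_top
            (hrad ▸ hQ.radical_le_iff.2 hle)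
        have hM : (P.comap (Ideal.Quotient.mk (J.ideal c))).IsMaximal :=
          hmax ▸ maximalIdeal.isMaximal A
        have := Ideal.map_eq_top_or_isMaximal_of_surjective _
          (Ideal.Quotient.mk_surjective (I := J.ideal c)) hM
        rw [Ideal.map_comap_of_surjective _ Ideal.Quotient.mk_surjective] at this
        exact this.resolve_left hP.ne_top
      have hart : IsArtinianRing (A ⧸ J.ideal c) :=
        isArtinianRing_iff_isNoetherianRing_krullDimLE_zero.2 ⟨inferInstance, hz⟩
      rw [Module.length_eq_of_surjective (R := A ⧸ J.ideal c) (S := A)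
        (M := A ⧸ J.ideal c) Ideal.Quotient.mk_surjective]
      exact Module.length_ne_top
  let f : (J.leftIdeal c ⧸ (J.ideal c).submoduleOf (J.leftIdeal c)) →ₗ[A] A ⧸ J.ideal c :=
    Submodule.mapQ _ _ (J.leftIdeal c).subtype le_rfl
  have hf : Function.Injective f := by
    rw [← LinearMap.ker_eq_bot]
    exact Submodule.ker_liftQ_eq_bot _ _ _ (by
      rw [LinearMap.ker_comp, Submodule.ker_mkQ]
      exact le_rfl)
  exact ne_top_of_le_ne_top hfin (Module.length_le_of_injective f hf)

/-- The Poincaré series `∑_{c > 0} m(c) T^c`, as a formal series with real exponents. -/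
noncomputable def poincareSeries (J : RGoodFiltration 𝔞) : HahnSeries ℝ ℚ where
  coeff c := if 0 < c then (J.multiplicity c : ℚ) else 0
  isPWO_support' := by
    obtain ⟨S, -, hfin, hconst⟩ := J.discrete
    refine Set.IsPWO.mono (t := S) ?_ ?_
    · refine Set.IsWF.isPWO (Set.isWF_iff_no_descending_seq.2 fun f hf hS => ?_)
      have hinf : (Set.range f).Infinite := Set.infinite_range_of_injective hf.injective
      refine hinf ((hfin (f 0)).subset ?_)
      rintro _ ⟨n, rfl⟩
      exact ⟨hS n, hf.antitone (Nat.zero_le n)⟩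
    · intro c hc
      by_contra hS
      refine hc ?_
      dsimp only
      split_ifs with h
      · rw [J.multiplicity_eq_zero_of_notMem hfin hconst h hS, Nat.cast_zero]
      · rfl

end RGoodFiltration

/-- The formal power `T^x`, with real exponent `x`, in the field of Hahn series. -/
noncomputable def formalPow (x : ℝ) : HahnSeries ℝ ℚ := HahnSeries.single x 1

/-- The expression
`m(c) + m(c+1) T + ⋯ + m(c+d-2) T^{d-2} + m(c+d-1) T^{d-1} / (1-T)^d
  + T^d (α_d / (1-T)^d + ⋯ + α_1 / (1-T) + p(T))`
in the field of Hahn series. -/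
noncomputable def poincareBracket (m : ℝ → ℕ) (d : ℕ) (c : ℝ) (α : ℕ → ℤ)
    (p : Polynomial ℤ) : HahnSeries ℝ ℚ :=
  ∑ i ∈ Finset.range (d - 1), (m (c + i) : HahnSeries ℝ ℚ) * formalPow 1 ^ i
    + (m (c + d - 1) : HahnSeries ℝ ℚ) * formalPow 1 ^ (d - 1) / (1 - formalPow 1) ^ d
    + formalPow 1 ^ d * (∑ i ∈ Finset.Icc 1 d, (α i : HahnSeries ℝ ℚ) / (1 - formalPow 1) ^ i
      + Polynomial.aeval (formalPow 1) p)

/-!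
Since the integers `α i` and the polynomial `p` are arbitrary, the expression
`T ^ d * (∑ α i / (1 - T) ^ i + p)` stands for an arbitrary element of `T ^ d ℤ[T] / (1 - T) ^ d`
(`exists_partialFractions`). The term `m(c + d - 1) T ^ (d - 1) / (1 - T) ^ d` differs from its
leading term by such an element. Hence the bracket of `c` can be made equal to
`F_c = ∑ m(c + n) T ^ n` as soon as `(1 - T) ^ d * ∑ m(c + d + n) T ^ n` is a polynomial
(`exists_poincareBracket_eq`), and `∑ F_c T ^ c` over `c ∈ (0, 1]` is the Poincaré series with its
exponents sorted modulo `1`.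

For `c > d` the recursion `J_c = 𝔞 J_{c-1}` gives `m(c + n) = λ(𝔞 ^ n M / 𝔞 ^ n N)` with `N = J_c`
and `M = J_{c-ε}`. So `m(c + n)` is the Hilbert function of a finitely generated graded module over
the Rees algebra of `𝔞`, with components of finite length, and the Hilbert–Serre theorem gives the
denominator `(1 - T) ^ d`, as `𝔞` has `d` generators.

The Hilbert–Serre theorem (`exists_polynomial_eq_hilbertSeries`) is proved by the usual induction
on the number of operators, for graded modules of the form `⨁ U n / L n` with ideals `L n ≤ U n`
of `A`. This class is closed under passing to the kernel and the cokernel of an operator, and the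
graded submodules of both are again families of ideals between `L` and `U`, so the Noetherian
hypothesis is inherited at once. It holds to begin with because the Rees algebra is Noetherian
(`monotone_stabilizes_of_le_pow`).
-/

/-! ### Colengths of ideals -/

section Colength

variable {A : Type*} [CommRing A]

/-- The colength `λ(A / I)` of an ideal, as an integer. It is `0` when the length is infinite, so
the lemmas about it assume finite length. -/
noncomputable def colength (I : Ideal A) : ℤ := ((Module.length A (A ⧸ I)).toNat : ℤ)

theorem length_quotient_ne_top_of_le {L U : Ideal A} (h : L ≤ U)
    (hL : Module.length A (A ⧸ L) ≠ ⊤) : Module.length A (A ⧸ U) ≠ ⊤ :=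
  ne_top_of_le_ne_top hL <|
    Module.length_le_of_surjective (Submodule.factor h) (Submodule.factor_surjective h)

theorem length_quotient_eq_add {L U : Ideal A} (h : L ≤ U) :
    Module.length A (A ⧸ L) =
      Module.length A (U ⧸ L.submoduleOf U) + Module.length A (A ⧸ U) := by
  let f : (U ⧸ L.submoduleOf U) →ₗ[A] A ⧸ L := Submodule.mapQ _ _ U.subtype le_rfl
  have hf : Function.Injective f := by
    rw [← LinearMap.ker_eq_bot]
    exact Submodule.ker_liftQ_eq_bot _ _ _ (by
      rw [LinearMap.ker_comp, Submodule.ker_mkQ]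
      exact le_rfl)
  refine Module.length_eq_add_of_exact f (Submodule.factor h) hf (Submodule.factor_surjective h) ?_
  rw [LinearMap.exact_iff]
  ext y
  obtain ⟨y, rfl⟩ := Submodule.Quotient.mk_surjective _ y
  constructor
  · intro hy
    have hyU : y ∈ U := by
      rw [LinearMap.mem_ker] at hy
      exact (Submodule.Quotient.mk_eq_zero U).1 hy
    exact ⟨Submodule.Quotient.mk ⟨y, hyU⟩, rfl⟩
  · rintro ⟨z, hz⟩
    obtain ⟨z, rfl⟩ := Submodule.Quotient.mk_surjective _ z
    rw [← hz, LinearMap.mem_ker]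
    exact (Submodule.Quotient.mk_eq_zero U).2 z.2

theorem toNat_length_subquotient {L U : Ideal A} (h : L ≤ U)
    (hL : Module.length A (A ⧸ L) ≠ ⊤) :
    ((Module.length A (U ⧸ L.submoduleOf U)).toNat : ℤ) = colength L - colength U := by
  have h1 := length_quotient_eq_add h
  have h2 : Module.length A (U ⧸ L.submoduleOf U) ≠ ⊤ := fun h3 => hL (by simp [h1, h3])
  rw [colength, colength, h1, ENat.toNat_add h2 (length_quotient_ne_top_of_le h hL)]
  push_cast
  ring

/-- Multiplication by `x` induces an isomorphism `U / (U ∩ (L : x)) ≅ (L + x U) / L`. -/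
theorem length_mul_subquotient (L U : Ideal A) (x : A) :
    Module.length A ((L ⊔ Submodule.map (LinearMap.mulLeft A x) U : Ideal A) ⧸
        L.submoduleOf (L ⊔ Submodule.map (LinearMap.mulLeft A x) U)) =
      Module.length A (U ⧸ (U ⊓ Submodule.comap (LinearMap.mulLeft A x) L).submoduleOf U) := by
  set W : Ideal A := L ⊔ Submodule.map (LinearMap.mulLeft A x) U
  let g : U →ₗ[A] A ⧸ L := L.mkQ ∘ₗ LinearMap.mulLeft A x ∘ₗ U.subtype
  let h : W →ₗ[A] A ⧸ L := L.mkQ ∘ₗ W.subtype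
  have hg : LinearMap.ker g = (U ⊓ Submodule.comap (LinearMap.mulLeft A x) L).submoduleOf U := by
    ext y
    simp [g, Submodule.submoduleOf, LinearMap.mem_ker]
    rw [← map_mul, Ideal.Quotient.eq_zero_iff_mem]
  have hh : LinearMap.ker h = L.submoduleOf W := by
    ext y
    simp [h, Submodule.submoduleOf, LinearMap.mem_ker, Ideal.Quotient.eq_zero_iff_mem]
  have hr : LinearMap.range h = LinearMap.range g := by
    simp only [h, g, W, LinearMap.range_comp, Submodule.range_subtype, Submodule.map_sup,
      Submodule.mkQ_map_self, bot_sup_eq]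
  rw [← hg, ← hh, (LinearMap.quotKerEquivRange h).length_eq,
    (LinearMap.quotKerEquivRange g).length_eq, hr]

theorem colength_sub_colength_sup_mul {L U : Ideal A} (x : A)
    (hL : Module.length A (A ⧸ L) ≠ ⊤)
    (hV : Module.length A (A ⧸ (U ⊓ Submodule.comap (LinearMap.mulLeft A x) L)) ≠ ⊤) :
    colength L - colength (L ⊔ Submodule.map (LinearMap.mulLeft A x) U) =
      colength (U ⊓ Submodule.comap (LinearMap.mulLeft A x) L) - colength U := by
  rw [← toNat_length_subquotient le_sup_left hL, length_mul_subquotient,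
    toNat_length_subquotient inf_le_left hV]

end Colength

/-! ### Rationality of Hilbert series -/

section HilbertSerre

open PowerSeries

variable {A : Type*} [CommRing A]

theorem exists_polynomial_coe_eq_mk {f : ℕ → ℤ} {k : ℕ} (hf : ∀ n, k ≤ n → f n = 0) :
    ∃ q : Polynomial ℤ, (q : ℤ⟦X⟧) = PowerSeries.mk f := by
  refine ⟨PowerSeries.trunc k (PowerSeries.mk f), ?_⟩
  ext n
  rw [Polynomial.coeff_coe, coeff_trunc]
  split_ifs with h
  · rfl
  · rw [coeff_mk, hf n (not_lt.1 h)]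

/-- The Hilbert–Serre theorem for the graded module `⨁ U n / L n` attached to two families of
ideals, on which the list `l` acts by multiplication, raising the degree by one. The hypothesis
`hacc` says that this module is Noetherian: chains of graded submodules become stationary. -/
theorem exists_polynomial_eq_hilbertSeries (l : List A) (L U : ℕ → Ideal A)
    (hLU : ∀ n, L n ≤ U n) (hfin : ∀ n, Module.length A (A ⧸ L n) ≠ ⊤)
    (hL : ∀ x ∈ l, ∀ n, ∀ y ∈ L n, x * y ∈ L (n + 1))
    (hU : ∀ x ∈ l, ∀ n, ∀ y ∈ U n, x * y ∈ U (n + 1))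
    (hacc : ∀ N : ℕ → ℕ → Ideal A, Monotone N → (∀ k n, L n ≤ N k n ∧ N k n ≤ U n) →
      (∀ k, ∀ x ∈ l, ∀ n, ∀ y ∈ N k n, x * y ∈ N k (n + 1)) → ∃ k, ∀ j, k ≤ j → N k = N j) :
    ∃ q : Polynomial ℤ, (q : ℤ⟦X⟧) =
      (1 - X) ^ l.length * PowerSeries.mk fun n => colength (L n) - colength (U n) := by
  induction l generalizing L U with
  | nil =>
    -- Without operators, `U` in degrees below `k` and `L` beyond is a chain of graded submodules.
    obtain ⟨k, hk⟩ := hacc (fun k n => if n < k then U n else L n)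
      (fun k k' hkk' n => by
        dsimp only
        split_ifs with h1 h2 h2
        · exact le_rfl
        · exact absurd (h1.trans_le hkk') h2
        · exact hLU n
        · exact le_rfl)
      (fun k n => by split_ifs <;> simp [hLU n])
      (by simp)
    obtain ⟨q, hq⟩ := exists_polynomial_coe_eq_mk
      (f := fun n => colength (L n) - colength (U n)) (k := k) fun n hn => by
        have h := congrFun (hk (n + 1) (by omega)) n
        simp only [not_lt.2 hn, if_false, Nat.lt_succ_self, if_true] at h
        rw [h, sub_self]
    exact ⟨q, by simpa using hq⟩
  | cons x l ih =>
    simp only [List.mem_cons, forall_eq_or_imp] at hL hU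
    -- The kernel of `x` is `⨁ U' n / L n` and the cokernel is `⨁ U n / L' n`.
    -- In degree `0` the truncated `n - 1` makes `L' 0 = L 0 + x U 0` instead of `L 0`. This is
    -- harmless: it changes the series by a constant, absorbed by `c` below.
    let U' : ℕ → Ideal A := fun n => U n ⊓ Submodule.comap (LinearMap.mulLeft A x) (L (n + 1))
    let L' : ℕ → Ideal A := fun n => L n ⊔ Submodule.map (LinearMap.mulLeft A x) (U (n - 1))
    have hLU' : ∀ n, L n ≤ U' n := fun n => le_inf (hLU n) fun y hy => hL.1 n y hy
    have hL'U : ∀ n, L' n ≤ U n := fun n => sup_le (hLU n) <| by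
      rintro _ ⟨y, hy, rfl⟩
      cases n with
      | zero => exact (U 0).mul_mem_left x hy
      | succ n => exact hU.1 n y hy
    have hLL' : ∀ n, L n ≤ L' n := fun n => le_sup_left
    obtain ⟨q₁, hq₁⟩ := ih L U' hLU' hfin hL.2
      (fun f hf n y hy => ⟨hU.2 f hf n y hy.1, by
        have := hL.2 f hf (n + 1) _ hy.2
        simpa [mul_left_comm] using this⟩)
      (fun N hN hLNU hl => hacc N hN
        (fun k n => ⟨(hLNU k n).1, (hLNU k n).2.trans inf_le_left⟩) fun k f hf n y hy => by
          rcases List.mem_cons.1 hf with rfl | hf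
          · exact (hLNU k (n + 1)).1 ((hLNU k n).2 hy).2
          · exact hl k f hf n y hy)
    obtain ⟨q₂, hq₂⟩ := ih L' U hL'U (fun n => length_quotient_ne_top_of_le (hLL' n) (hfin n))
      (fun f hf n y hy => by
        obtain ⟨a, ha, _, ⟨b, hb, rfl⟩, rfl⟩ := Submodule.mem_sup.1 hy
        rw [mul_add]
        refine add_mem (Submodule.mem_sup_left (hL.2 f hf n a ha))
          (Submodule.mem_sup_right ⟨f * b, ?_, ?_⟩)
        · cases n with
          | zero => exact (U 0).mul_mem_left f hb
          | succ n => exact hU.2 f hf n b hb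
        · simp only [LinearMap.mulLeft_apply]
          ring)
      hU.2
      (fun N hN hLNU hl => hacc N hN
        (fun k n => ⟨(hLL' n).trans (hLNU k n).1, (hLNU k n).2⟩) fun k f hf n y hy => by
          rcases List.mem_cons.1 hf with rfl | hf
          · exact (hLNU k (n + 1)).1 (Submodule.mem_sup_right ⟨y, (hLNU k n).2 hy, rfl⟩)
          · exact hl k f hf n y hy)
    set c : ℤ := colength (L 0) - colength (L' 0)
    have key : (1 - X) * PowerSeries.mk (fun n => colength (L n) - colength (U n)) =
        C c + PowerSeries.mk (fun n => colength (L' n) - colength (U n)) -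
          X * PowerSeries.mk (fun n => colength (L n) - colength (U' n)) := by
      ext n
      rw [sub_mul, one_mul]
      cases n with
      | zero => simp [c]
      | succ n =>
        have := colength_sub_colength_sup_mul (L := L (n + 1)) (U := U n) x
          (hfin (n + 1)) (length_quotient_ne_top_of_le (hLU' n) (hfin n))
        simp only [map_sub, map_add, coeff_mk, coeff_succ_X_mul, coeff_C, Nat.succ_ne_zero,
          if_false, zero_add]
        simp only [L', U', Nat.add_sub_cancel]
        linarith
    refine ⟨(1 - Polynomial.X) ^ l.length * Polynomial.C c + q₂ - Polynomial.X * q₁, ?_⟩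
    rw [List.length_cons, pow_succ, mul_assoc, key]
    push_cast
    rw [hq₁, hq₂]
    ring

end HilbertSerre

/-! ### Chains of graded submodules of the Rees algebra -/

section Rees

variable {A : Type*} [CommRing A]

/-- The ideal `⨁ N n` of the Rees algebra `⨁ 𝔞 ^ n` given by a family of ideals of `A` with
`𝔞 * N n ≤ N (n + 1)`. -/
def reesIdeal {𝔞 : Ideal A} (N : ℕ → Ideal A) (hN : ∀ n, 𝔞 * N n ≤ N (n + 1)) :
    Ideal (reesAlgebra 𝔞) where
  carrier := {f | ∀ n, (f : Polynomial A).coeff n ∈ N n}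
  add_mem' hf hg n := by
    simpa using add_mem (hf n) (hg n)
  zero_mem' n := by simp
  smul_mem' f g hg n := by
    have hpow : ∀ i j, 𝔞 ^ i * N j ≤ N (i + j) := by
      intro i j
      induction i with
      | zero => simp
      | succ i ih =>
        rw [pow_succ', mul_assoc, add_right_comm]
        exact (Ideal.mul_mono_right ih).trans (hN _)
    rw [smul_eq_mul, MulMemClass.coe_mul, Polynomial.coeff_mul]
    refine sum_mem fun ij hij => ?_
    rw [← Finset.HasAntidiagonal.mem_antidiagonal.1 hij]
    exact hpow _ _ (Ideal.mul_mem_mul (f.2 _) (hg _))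

theorem monomial_mem_reesIdeal {𝔞 : Ideal A} {N : ℕ → Ideal A}
    (hN : ∀ n, 𝔞 * N n ≤ N (n + 1)) {n : ℕ} {y : A} (hy : y ∈ 𝔞 ^ n) :
    (⟨Polynomial.monomial n y, reesAlgebra.monomial_mem.2 hy⟩ : reesAlgebra 𝔞) ∈
      reesIdeal N hN ↔ y ∈ N n := by
  constructor
  · intro h
    simpa using h n
  · intro h m
    simp only [Polynomial.coeff_monomial]
    split_ifs with hnm
    · exact hnm ▸ h
    · exact zero_mem _

/-- Families of ideals `N n ≤ 𝔞 ^ n` with `𝔞 * N n ≤ N (n + 1)` satisfy the ascending chain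
condition, because the Rees algebra is Noetherian. -/
theorem monotone_stabilizes_of_le_pow [IsNoetherianRing A] (𝔞 : Ideal A) (N : ℕ → ℕ → Ideal A)
    (hmono : Monotone N) (hle : ∀ k n, N k n ≤ 𝔞 ^ n) (hN : ∀ k n, 𝔞 * N k n ≤ N k (n + 1)) :
    ∃ k, ∀ j, k ≤ j → N k = N j := by
  obtain ⟨k, hk⟩ := monotone_stabilizes_iff_noetherian.2
    (inferInstance : IsNoetherian (reesAlgebra 𝔞) (reesAlgebra 𝔞))
    ⟨fun k => reesIdeal (N k) (hN k), fun i j hij f hf n => hmono hij n (hf n)⟩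
  refine ⟨k, fun j hj => le_antisymm (hmono hj) fun n y hy => ?_⟩
  have hk' : reesIdeal (N k) (hN k) = reesIdeal (N j) (hN j) := hk j hj
  exact (monomial_mem_reesIdeal (hN k) (hle j n hy)).1
    (hk' ▸ (monomial_mem_reesIdeal (hN j) (hle j n hy)).2 hy)

/-- For `N ≤ M` with `A / 𝔞 ^ n N` of finite length, the Hilbert series of `⨁ 𝔞 ^ n M / 𝔞 ^ n N`
has denominator `(1 - X) ^ d` if `𝔞` is generated by `d` elements. -/
theorem exists_polynomial_eq_hilbertSeries_pow_mul [IsNoetherianRing A] {d : ℕ} (f : Fin d → A)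
    {𝔞 : Ideal A} (h𝔞 : 𝔞 = Ideal.span (Set.range f)) {N M : Ideal A} (hNM : N ≤ M)
    (hfin : ∀ n, Module.length A (A ⧸ 𝔞 ^ n * N) ≠ ⊤) :
    ∃ q : Polynomial ℤ, (q : PowerSeries ℤ) = (1 - PowerSeries.X) ^ d *
      PowerSeries.mk fun n => colength (𝔞 ^ n * N) - colength (𝔞 ^ n * M) := by
  have hmem : ∀ x ∈ List.ofFn f, x ∈ 𝔞 := by
    intro x hx
    rw [h𝔞]
    exact Ideal.subset_span ((List.mem_ofFn' f x).1 hx)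
  have hstep : ∀ (I : Ideal A), ∀ x ∈ List.ofFn f, ∀ n, ∀ y ∈ 𝔞 ^ n * I,
      x * y ∈ 𝔞 ^ (n + 1) * I := by
    intro I x hx n y hy
    rw [pow_succ', mul_assoc]
    exact Ideal.mul_mem_mul (hmem x hx) hy
  have := exists_polynomial_eq_hilbertSeries (List.ofFn f) (fun n => 𝔞 ^ n * N)
    (fun n => 𝔞 ^ n * M) (fun n => Ideal.mul_mono_right hNM) hfin (hstep N) (hstep M)
    (fun K hK hle hl => monotone_stabilizes_of_le_pow 𝔞 K hK
      (fun k n => (hle k n).2.trans Ideal.mul_le_left) fun k n => by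
        refine Ideal.mul_le.2 fun r hr y hy => ?_
        suffices 𝔞 ≤ Submodule.comap (LinearMap.mulRight A y) (K k (n + 1)) from this hr
        rw [h𝔞, Ideal.span_le]
        rintro _ ⟨i, rfl⟩
        exact hl k (f i) ((List.mem_ofFn' f _).2 ⟨i, rfl⟩) n y hy)
  rwa [List.length_ofFn] at this

end Rees

/-! ### Multiplicities of a good filtration -/

section Local

variable {A : Type*} [CommRing A] [IsLocalRing A] [IsNoetherianRing A]

theorem IsMaximalPrimary.length_quotient_ne_top {I : Ideal A} (hI : IsMaximalPrimary I) :
    Module.length A (A ⧸ I) ≠ ⊤ := by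
  have hz : Ring.KrullDimLE 0 (A ⧸ I) := by
    rw [Ring.krullDimLE_zero_iff]
    intro P hP
    have hQ : (P.comap (Ideal.Quotient.mk I)).IsPrime := hP.comap _
    have hle : I ≤ P.comap (Ideal.Quotient.mk I) := by
      intro x hx
      rw [Ideal.mem_comap, Ideal.Quotient.eq_zero_iff_mem.2 hx]
      exact P.zero_mem
    have hmax : maximalIdeal A = P.comap (Ideal.Quotient.mk I) :=
      (maximalIdeal.isMaximal A).eq_of_le hQ.ne_top (hI.2 ▸ hQ.radical_le_iff.2 hle)
    have hM : (P.comap (Ideal.Quotient.mk I)).IsMaximal := hmax ▸ maximalIdeal.isMaximal A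
    have := Ideal.map_eq_top_or_isMaximal_of_surjective _
      (Ideal.Quotient.mk_surjective (I := I)) hM
    rw [Ideal.map_comap_of_surjective _ Ideal.Quotient.mk_surjective] at this
    exact this.resolve_left hP.ne_top
  have hart : IsArtinianRing (A ⧸ I) :=
    isArtinianRing_iff_isNoetherianRing_krullDimLE_zero.2 ⟨inferInstance, hz⟩
  rw [Module.length_eq_of_surjective (R := A ⧸ I) (S := A) (M := A ⧸ I)
    Ideal.Quotient.mk_surjective]
  exact Module.length_ne_top

end Local

namespace RGoodFiltration

variable {A : Type*} [CommRing A] {𝔞 : Ideal A}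

theorem ideal_le_leftIdeal (J : RGoodFiltration 𝔞) {c : ℝ} (hc : 0 ≤ c) :
    J.ideal c ≤ J.leftIdeal c :=
  le_iInf₂ fun _ hb => J.antitone hb.1 hc hb.2.le

/-- Since `leftIdeal` is an attained limit from the left, it inherits the recursion of `J`. -/
theorem leftIdeal_add_one (J : RGoodFiltration 𝔞) {d c : ℝ} (hd : 0 ≤ d)
    (h : ∀ b : ℝ, d < b → J.ideal b = 𝔞 * J.ideal (b - 1)) (hc : d < c) :
    J.leftIdeal (c + 1) = 𝔞 * J.leftIdeal c := by
  have hε : ∀ᶠ ε in 𝓝[>] (0 : ℝ), ε < c - d :=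
    eventually_nhdsWithin_of_eventually_nhds (eventually_lt_nhds (sub_pos.2 hc))
  obtain ⟨ε, h1, h2, h3⟩ := ((J.eventually_eq_leftIdeal (c := c) (by linarith)).and
    ((J.eventually_eq_leftIdeal (c := c + 1) (by linarith)).and hε)).exists
  rw [h1, h2, h _ (by linarith)]
  congr 2
  ring

theorem ideal_add_nat (J : RGoodFiltration 𝔞) {d c : ℝ}
    (h : ∀ b : ℝ, d < b → J.ideal b = 𝔞 * J.ideal (b - 1)) (hc : d < c) (n : ℕ) :
    J.ideal (c + n) = 𝔞 ^ n * J.ideal c := by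
  induction n with
  | zero => simp
  | succ n ih =>
    have hn : (0 : ℝ) ≤ n := n.cast_nonneg
    rw [h _ (by push_cast; linarith), pow_succ', mul_assoc, ← ih]
    congr 2
    push_cast
    ring

theorem leftIdeal_add_nat (J : RGoodFiltration 𝔞) {d c : ℝ} (hd : 0 ≤ d)
    (h : ∀ b : ℝ, d < b → J.ideal b = 𝔞 * J.ideal (b - 1)) (hc : d < c) (n : ℕ) :
    J.leftIdeal (c + n) = 𝔞 ^ n * J.leftIdeal c := by
  induction n with
  | zero => simp
  | succ n ih =>
    have hn : (0 : ℝ) ≤ n := n.cast_nonneg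
    rw [Nat.cast_succ, ← add_assoc, J.leftIdeal_add_one hd h (by linarith), ih, pow_succ',
      mul_assoc]

theorem multiplicity_eq_colength_sub (J : RGoodFiltration 𝔞) {c : ℝ} (hc : 0 ≤ c)
    (hfin : Module.length A (A ⧸ J.ideal c) ≠ ⊤) :
    (J.multiplicity c : ℤ) = colength (J.ideal c) - colength (J.leftIdeal c) :=
  toNat_length_subquotient (J.ideal_le_leftIdeal hc) hfin

theorem ideal_eq_leftIdeal_of_multiplicity_eq_zero (J : RGoodFiltration 𝔞) {c : ℝ} (hc : 0 ≤ c)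
    (hfin : Module.length A (A ⧸ J.ideal c) ≠ ⊤) (h : J.multiplicity c = 0) :
    J.ideal c = J.leftIdeal c := by
  refine le_antisymm (J.ideal_le_leftIdeal hc) ?_
  have hlen := length_quotient_eq_add (J.ideal_le_leftIdeal hc)
  rw [multiplicity, ENat.toNat_eq_zero] at h
  have h0 := h.resolve_right fun h => hfin (by rw [hlen, h, top_add])
  rw [Module.length_eq_zero_iff, Submodule.Quotient.subsingleton_iff] at h0
  exact Submodule.submoduleOf_eq_top.1 h0

/-- The recursion propagates `m(c) = 0` upwards. -/
theorem multiplicity_add_nat_eq_zero (J : RGoodFiltration 𝔞) {d c : ℝ} (hd : 0 ≤ d)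
    (h : ∀ b : ℝ, d < b → J.ideal b = 𝔞 * J.ideal (b - 1)) (hc : d < c)
    (hfin : Module.length A (A ⧸ J.ideal c) ≠ ⊤) (hm : J.multiplicity c = 0) (n : ℕ) :
    J.multiplicity (c + n) = 0 := by
  have h0 := J.ideal_eq_leftIdeal_of_multiplicity_eq_zero (hd.trans hc.le) hfin hm
  rw [multiplicity, J.ideal_add_nat h hc, J.leftIdeal_add_nat hd h hc, h0,
    Submodule.submoduleOf_eq_top.2 le_rfl]
  simp

end RGoodFiltration

/-! ### Power series as Hahn series -/

section Hahn

/-- Integral power series in `T`, regarded as Hahn series with real exponents. -/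
noncomputable def powerSeriesToHahn : PowerSeries ℤ →+* HahnSeries ℝ ℚ :=
  (HahnSeries.ofPowerSeries ℝ ℚ).comp (PowerSeries.map (Int.castRingHom ℚ))

theorem powerSeriesToHahn_coeff_natCast (F : PowerSeries ℤ) (n : ℕ) :
    (powerSeriesToHahn F).coeff n = PowerSeries.coeff n F := by
  simp [powerSeriesToHahn, HahnSeries.ofPowerSeries_apply_coeff]

theorem powerSeriesToHahn_coeff_eq_zero (F : PowerSeries ℤ) {x : ℝ} (hx : ∀ n : ℕ, x ≠ n) :
    (powerSeriesToHahn F).coeff x = 0 := by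
  rw [powerSeriesToHahn, RingHom.comp_apply, HahnSeries.ofPowerSeries_apply]
  refine HahnSeries.embDomain_of_notMem_range ?_
  rintro ⟨n, rfl⟩
  exact hx n rfl

theorem powerSeriesToHahn_X : powerSeriesToHahn PowerSeries.X = formalPow 1 := by
  simp [powerSeriesToHahn, formalPow]

theorem powerSeriesToHahn_coe (q : Polynomial ℤ) :
    powerSeriesToHahn (q : PowerSeries ℤ) = Polynomial.aeval (formalPow 1) q := by
  have : powerSeriesToHahn.comp Polynomial.coeToPowerSeries.ringHom =
      (Polynomial.aeval (formalPow 1) : Polynomial ℤ →ₐ[ℤ] HahnSeries ℝ ℚ).toRingHom := by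
    refine Polynomial.ringHom_ext (fun a => ?_) ?_
    · simp
    · simp [powerSeriesToHahn_X]
  exact DFunLike.congr_fun this q

theorem one_sub_formalPow_one_ne_zero : (1 : HahnSeries ℝ ℚ) - formalPow 1 ≠ 0 := by
  intro h
  have := congrArg (fun x : HahnSeries ℝ ℚ => x.coeff 0) h
  simp [formalPow, HahnSeries.coeff_single_of_ne] at this

/-- The expansion of `q(t) / (1 - t) ^ d` in powers of `1 - t`. -/
theorem exists_partialFractions {K : Type*} [Field K] [Algebra ℤ K] {t : K} (ht : 1 - t ≠ 0)
    (d : ℕ) (q : Polynomial ℤ) : ∃ (α : ℕ → ℤ) (p : Polynomial ℤ),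
      Polynomial.aeval t q / (1 - t) ^ d =
        ∑ i ∈ Finset.Icc 1 d, (α i : K) / (1 - t) ^ i + Polynomial.aeval t p := by
  induction d generalizing q with
  | zero => exact ⟨0, q, by simp⟩
  | succ d ih =>
    obtain ⟨r, hr⟩ : Polynomial.X - Polynomial.C 1 ∣ q - Polynomial.C (q.eval 1) :=
      Polynomial.X_sub_C_dvd_sub_C_eval
    obtain ⟨α, p, h⟩ := ih (-r)
    refine ⟨Function.update α (d + 1) (q.eval 1), p, ?_⟩
    have hr' := congrArg (Polynomial.aeval t) hr
    rw [map_sub, Polynomial.aeval_C, eq_intCast, map_mul, map_sub, Polynomial.aeval_X, map_one,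
      map_one] at hr'
    have hsum : ∑ i ∈ Finset.Icc 1 d,
        ((Function.update α (d + 1) (q.eval 1) i : ℤ) : K) / (1 - t) ^ i =
        ∑ i ∈ Finset.Icc 1 d, (α i : K) / (1 - t) ^ i := by
      refine Finset.sum_congr rfl fun i hi => ?_
      rw [Function.update_of_ne (by have := (Finset.mem_Icc.1 hi).2; omega)]
    rw [Finset.sum_Icc_succ_top (by omega), hsum, Function.update_self, add_right_comm, ← h,
      map_neg, eq_add_of_sub_eq hr']
    field_simp
    ring

/-- If the tail of `F = ∑ m (c + n) T ^ n` from degree `d` on is `q / (1 - T) ^ d`, then `F` can be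
written as a bracket. -/
theorem exists_poincareBracket_eq (m : ℝ → ℕ) {d : ℕ} (hd : 1 ≤ d) (c : ℝ) (q : Polynomial ℤ)
    (hq : (q : PowerSeries ℤ) =
      (1 - PowerSeries.X) ^ d * PowerSeries.mk fun n : ℕ => (m (c + d + n) : ℤ)) :
    ∃ (α : ℕ → ℤ) (p : Polynomial ℤ), poincareBracket m d c α p =
      powerSeriesToHahn (PowerSeries.mk fun n : ℕ => (m (c + n) : ℤ)) := by
  -- `w` accounts for the terms of `T ^ (d - 1) / (1 - T) ^ d` of degree at least `d`.
  obtain ⟨w, hw⟩ : (Polynomial.X : Polynomial ℤ) ∣ 1 - (1 - Polynomial.X) ^ d := by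
    rw [Polynomial.X_dvd_iff, Polynomial.coeff_zero_eq_eval_zero]
    simp
  obtain ⟨e, rfl⟩ : ∃ e, d = e + 1 := ⟨d - 1, by omega⟩
  have hsplit : (PowerSeries.mk fun n : ℕ => (m (c + n) : ℤ)) =
      ∑ i ∈ Finset.range (e + 1), (m (c + i) : PowerSeries ℤ) * PowerSeries.X ^ i +
        PowerSeries.X ^ (e + 1) *
          PowerSeries.mk fun n : ℕ => (m (c + (e + 1 : ℕ) + n) : ℤ) := by
    ext n
    have hC : ∀ i : ℕ, (m (c + i) : PowerSeries ℤ) = PowerSeries.C (m (c + i) : ℤ) := by simp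
    simp only [hC, map_add, map_sum, PowerSeries.coeff_C_mul, PowerSeries.coeff_X_pow, mul_ite,
      mul_one, mul_zero, PowerSeries.coeff_mk, Finset.sum_ite_eq, Finset.mem_range,
      PowerSeries.coeff_X_pow_mul']
    split_ifs with h1 h2 h2
    · omega
    · simp
    · rw [zero_add, add_assoc, ← Nat.cast_add, Nat.add_sub_cancel' h2]
    · omega
  set t : HahnSeries ℝ ℚ := formalPow 1 with ht
  have ht1 : 1 - t ≠ 0 := one_sub_formalPow_one_ne_zero
  obtain ⟨α, p, hαp⟩ : ∃ (α : ℕ → ℤ) (p : Polynomial ℤ),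
      Polynomial.aeval t (q - (m (c + e) : ℤ) • w) / (1 - t) ^ (e + 1) =
        ∑ i ∈ Finset.Icc 1 (e + 1), (α i : HahnSeries ℝ ℚ) / (1 - t) ^ i +
          Polynomial.aeval t p :=
    exists_partialFractions ht1 (e + 1) (q - (m (c + e) : ℤ) • w)
  refine ⟨α, p, ?_⟩
  have hw' := congrArg (Polynomial.aeval t) hw
  have hq' := congrArg powerSeriesToHahn hq
  have hcast : c + ((e + 1 : ℕ) : ℝ) - 1 = c + e := by
    push_cast
    ring
  rw [powerSeriesToHahn_coe] at hq'
  rw [poincareBracket, ← ht, ← hαp, hsplit, hcast]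
  simp only [map_mul, map_sub, map_pow, map_one, map_add, map_sum, map_natCast,
    powerSeriesToHahn_X, Polynomial.aeval_X, ← ht, Nat.add_sub_cancel, Finset.sum_range_succ,
    zsmul_eq_mul, Int.cast_natCast] at hw' hq' ⊢
  rw [hq', add_assoc, add_assoc]
  congr 1
  field_simp
  linear_combination (m (c + e) : HahnSeries ℝ ℚ) * t ^ e * hw'

end Hahn

/-! ### The Poincaré series -/

/-- Sorting the exponents `x > 0` by their class modulo `1`, with representatives in `(0, 1]`. -/
theorem coeff_finsum_powerSeriesToHahn_mul_formalPow (F : ℝ → PowerSeries ℤ)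
    (hF : {c ∈ Set.Ioc (0 : ℝ) 1 | F c ≠ 0}.Finite) (m : ℝ → ℕ)
    (hm : ∀ c ∈ Set.Ioc (0 : ℝ) 1, ∀ n : ℕ, PowerSeries.coeff n (F c) = m (c + n)) (x : ℝ) :
    (∑ᶠ c ∈ Set.Ioc (0 : ℝ) 1, powerSeriesToHahn (F c) * formalPow c).coeff x =
      if 0 < x then (m x : ℚ) else 0 := by
  have hsupp : (Set.Ioc (0 : ℝ) 1 ∩
      Function.support fun c => powerSeriesToHahn (F c) * formalPow c).Finite := by
    refine hF.subset fun c hc => ⟨hc.1, fun h => hc.2 ?_⟩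
    simp [h]
  have hcoeff : ∀ c, (powerSeriesToHahn (F c) * formalPow c).coeff x =
      (powerSeriesToHahn (F c)).coeff (x - c) := by
    intro c
    rw [formalPow, HahnSeries.coeff_mul_single, mul_one]
  have hsum := (HahnSeries.coeff.addMonoidHom x).map_finsum_mem' hsupp
  simp only [HahnSeries.coeff.addMonoidHom, AddMonoidHom.coe_mk, ZeroHom.coe_mk, hcoeff] at hsum
  rw [hsum]
  split_ifs with hx
  · -- The representative of `x` in `(0, 1]` is `x - (⌈x⌉ - 1)`.
    have hceil : 1 ≤ ⌈x⌉₊ := Nat.one_le_ceil_iff.2 hx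
    have hcast : ((⌈x⌉₊ - 1 : ℕ) : ℝ) = ⌈x⌉₊ - 1 := by
      rw [Nat.cast_sub hceil, Nat.cast_one]
    have h1 := Nat.le_ceil x
    have h2 := Nat.ceil_lt_add_one hx.le
    have hmem : x - (⌈x⌉₊ - 1 : ℕ) ∈ Set.Ioc (0 : ℝ) 1 := by
      rw [hcast]
      constructor <;> linarith
    rw [finsum_eq_single _ (x - (⌈x⌉₊ - 1 : ℕ)), finsum_eq_if, if_pos hmem, sub_sub_cancel,
      powerSeriesToHahn_coeff_natCast, hm _ hmem, sub_add_cancel, Int.cast_natCast]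
    intro c hc
    rw [finsum_eq_if]
    refine ite_eq_right_iff.2 fun hc1 =>
      powerSeriesToHahn_coeff_eq_zero _ fun n hn => hc ?_
    have hceil' : ⌈x⌉₊ = n + 1 := by
      rw [Nat.ceil_eq_iff (by omega)]
      push_cast
      constructor <;> linarith [hc1.1, hc1.2]
    rw [hceil', Nat.add_sub_cancel]
    linarith
  · refine finsum_mem_eq_zero_of_forall_eq_zero fun c hc =>
      powerSeriesToHahn_coeff_eq_zero _ fun n hn => hx ?_
    have hn0 : (0 : ℝ) ≤ n := n.cast_nonneg
    linarith [hc.1]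

namespace RGoodFiltration

variable {A : Type*} [CommRing A] {𝔞 : Ideal A}

theorem finite_setOf_multiplicity_ne_zero (J : RGoodFiltration 𝔞) (b : ℝ) :
    {c | 0 < c ∧ c ≤ b ∧ J.multiplicity c ≠ 0}.Finite := by
  obtain ⟨S, -, hfin, hconst⟩ := J.discrete
  refine (hfin b).subset fun c hc => ⟨?_, hc.2.1⟩
  by_contra h
  exact hc.2.2 (J.multiplicity_eq_zero_of_notMem hfin hconst hc.1 h)

/-- The multiplicities up to `d + 1` decide which classes modulo `1` occur. -/
theorem finite_setOf_exists_multiplicity_ne_zero (J : RGoodFiltration 𝔞) {d : ℕ}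
    (h : ∀ b : ℝ, (d : ℝ) < b → J.ideal b = 𝔞 * J.ideal (b - 1))
    (hfin : ∀ c : ℝ, 0 ≤ c → Module.length A (A ⧸ J.ideal c) ≠ ⊤) :
    {c ∈ Set.Ioc (0 : ℝ) 1 | ∃ n : ℕ, J.multiplicity (c + n) ≠ 0}.Finite := by
  have hd0 : (0 : ℝ) ≤ d := d.cast_nonneg
  refine ((Set.finite_Iic d).biUnion fun n _ =>
    (J.finite_setOf_multiplicity_ne_zero (d + 1)).image fun c => c - (n : ℝ)).subset ?_
  rintro c ⟨hc, n, hn⟩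
  obtain ⟨k, hk, hkm⟩ : ∃ k ≤ d, J.multiplicity (c + k) ≠ 0 := by
    rcases le_total n d with hnd | hnd
    · exact ⟨n, hnd, hn⟩
    · refine ⟨d, le_rfl, fun h0 => hn ?_⟩
      have hcd : (d : ℝ) < c + d := by linarith [hc.1]
      have := J.multiplicity_add_nat_eq_zero hd0 h hcd (hfin _ (by linarith)) h0 (n - d)
      rwa [add_assoc, ← Nat.cast_add, Nat.add_sub_cancel' hnd] at this
  have hk0 : (0 : ℝ) ≤ k := k.cast_nonneg
  have hkd : (k : ℝ) ≤ d := Nat.cast_le.2 hk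
  exact Set.mem_biUnion (Set.mem_Iic.2 hk)
    ⟨c + k, ⟨by linarith [hc.1], by linarith [hc.2], hkm⟩, add_sub_cancel_right c _⟩

/-- Beyond the degree where the recursion starts, the multiplicities in a class modulo `1` form
the Hilbert function of `⨁ 𝔞 ^ n M / 𝔞 ^ n N`, with `M = J_{c-ε}` and `N = J_c`. -/
theorem exists_polynomial_eq_multiplicity_series [IsNoetherianRing A] (J : RGoodFiltration 𝔞)
    {d : ℕ} (f : Fin d → A) (h𝔞 : 𝔞 = Ideal.span (Set.range f)) {b c : ℝ} (hb : 0 ≤ b)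
    (h : ∀ x : ℝ, b < x → J.ideal x = 𝔞 * J.ideal (x - 1)) (hc : b < c)
    (hfin : ∀ x : ℝ, 0 ≤ x → Module.length A (A ⧸ J.ideal x) ≠ ⊤) :
    ∃ q : Polynomial ℤ, (q : PowerSeries ℤ) = (1 - PowerSeries.X) ^ d *
      PowerSeries.mk fun n : ℕ => (J.multiplicity (c + n) : ℤ) := by
  have hc0 : ∀ n : ℕ, (0 : ℝ) ≤ c + n := fun n => by
    have : (0 : ℝ) ≤ n := n.cast_nonneg
    linarith
  have hm : ∀ n : ℕ, (J.multiplicity (c + n) : ℤ) =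
      colength (𝔞 ^ n * J.ideal c) - colength (𝔞 ^ n * J.leftIdeal c) := by
    intro n
    rw [J.multiplicity_eq_colength_sub (hc0 n) (hfin _ (hc0 n)), J.ideal_add_nat h hc,
      J.leftIdeal_add_nat hb h hc]
  simp only [hm]
  refine exists_polynomial_eq_hilbertSeries_pow_mul f h𝔞
    (J.ideal_le_leftIdeal (hb.trans hc.le)) fun n => ?_
  rw [← J.ideal_add_nat h hc]
  exact hfin _ (hc0 n)

end RGoodFiltration

theorem mainTheorem4 {A : Type*} [CommRing A] [IsLocalRing A] (hA : IsCohenMacaulayLocal A)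
    (d : ℕ) (hd : ringKrullDim A = d) (hd1 : 1 ≤ d)
    (𝔞 : Ideal A) (h𝔞 : IsParameterIdeal 𝔞)
    (J : RGoodFiltration 𝔞)
    (hJ : ∀ c : ℝ, 0 ≤ c → J.ideal c = ⊤ ∨ IsMaximalPrimary (J.ideal c))
    (hskoda : ∀ c : ℝ, (d : ℝ) < c → J.ideal c = 𝔞 * J.ideal (c - 1)) :
    ∃ (α : ℝ → ℕ → ℤ) (p : ℝ → Polynomial ℤ),
      {c ∈ Set.Ioc (0 : ℝ) 1 | poincareBracket J.multiplicity d c (α c) (p c) ≠ 0}.Finite ∧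
      J.poincareSeries = ∑ᶠ c ∈ Set.Ioc (0 : ℝ) 1,
        poincareBracket J.multiplicity d c (α c) (p c) * formalPow c := by
  have := hA.noetherian
  obtain ⟨d', f, hd', hf, -⟩ := h𝔞
  obtain rfl : d' = d := by
    rw [hd] at hd'
    exact_mod_cast hd'.symm
  have hfin : ∀ c : ℝ, 0 ≤ c → Module.length A (A ⧸ J.ideal c) ≠ ⊤ := by
    intro c hc
    rcases hJ c hc with h | h
    · have : Subsingleton (A ⧸ J.ideal c) := Ideal.Quotient.subsingleton_iff.2 h
      rw [Module.length_eq_zero]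
      exact ENat.zero_ne_top
    · exact h.length_quotient_ne_top
  let F : ℝ → PowerSeries ℤ := fun c => PowerSeries.mk fun n : ℕ => (J.multiplicity (c + n) : ℤ)
  have key : ∀ c : ℝ, 0 < c → ∃ (α : ℕ → ℤ) (p : Polynomial ℤ),
      poincareBracket J.multiplicity d' c α p = powerSeriesToHahn (F c) := by
    intro c hc
    obtain ⟨q, hq⟩ := J.exists_polynomial_eq_multiplicity_series f hf (c := c + d')
      (Nat.cast_nonneg d') hskoda (by linarith) hfin
    exact exists_poincareBracket_eq J.multiplicity hd1 c q hq
  choose! α p hαp using key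
  have hF : {c ∈ Set.Ioc (0 : ℝ) 1 | F c ≠ 0}.Finite := by
    refine (J.finite_setOf_exists_multiplicity_ne_zero hskoda hfin).subset ?_
    rintro c ⟨hc, hFc⟩
    refine ⟨hc, ?_⟩
    by_contra! h
    refine hFc ?_
    ext n
    simp [F, h n]
  refine ⟨α, p, hF.subset ?_, ?_⟩
  · rintro c ⟨hc, hne⟩
    refine ⟨hc, fun h => hne ?_⟩
    rw [hαp c hc.1, h, map_zero]
  · ext x
    rw [finsum_mem_congr rfl fun c hc => by rw [hαp c hc.1],
      coeff_finsum_powerSeriesToHahn_mul_formalPow F hF J.multiplicity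
        (fun c _ n => by simp [F]) x]
    rfl
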